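/- **Setting.** Let $P=\{p_1,\dots,p_n\}$ be points of a Euclidean space, one agent per point, and let $\alpha>0$. A strategy profile $\mathbf s$ gives each agent $u$ a set $S_u\subseteq P\setminus\{u\}$; the network $G(\mathbf s)$ has the undirected edges $uv$ with $v\in S_u$ or $u\in S_v$, and an edge $uv$ has length $\|u-v\|_2$. Let $d_G$ be the shortest-path distance in $G$ ($+\infty$ if there is no path). The cost of $u$ is $\alpha\sum_{v\in S_u}\|u-v\|_2+\sum_{v\in P}d_{G(\mathbf s)}(u,v)$, and the social cost is the sum of all agents' costs. $G(\mathbf s)$ is a $(\beta,\gamma)$-network if, for every agent $u$ and every change of $u$'s strategy alone, the cost of $u$ under $\mathbf s$ is at most $\beta$ times her cost after the change, and the social cost of $\mathbf s$ is at most $\gamma$ times the minimum social cost over all strategy profiles. For $C\subseteq P$, a $k$-degree $t$-spanner on $C$ is a graph $H$ on $C$ with all degrees at most $k$ and $d_H(u,v)\le t\|u-v\|_2$ for all $u,v\in C$. An ownership assignment gives each edge of $H$ to exactly one of its endpoints, such that each agent owns at most $k$ edges. **Algorithm 1.** The input is $P$, $k\in\mathbb N$, $t>1$, $b\ge1$ and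 a real number $c$ with $0\le c\le n-1$. Let $w_{\max}$ be the largest distance between two points of $P$, and for $v\in P$ let $B_v=\{u\in P:\|u-v\|_2\le w_{\max}/b\}$ and $C_v=\{u\in P:\|u-v\|_2\le 2w_{\max}/b\}$. If some $v\in P$ has $|P\setminus B_v|<c$, then for such a $v$ take a $k$-degree $t$-spanner on $C_v$ with an ownership assignment, and let every $u\in P\setminus C_v$ buy exactly one edge, to a closest point of $C_v$. Otherwise take a $k$-degree $t$-spanner on $P$ with an ownership assignment. All choices left open are arbitrary. **Theorem.** For every $\varepsilon>0$ there is $k=k_\varepsilon\in\mathbb N$, depending only on $\varepsilon$, such that the following holds for every real sequence $(\alpha_n)$ with $\alpha_n\in o(n)$. Let $P_n$ consist of $n$ independent, uniformly distributed points of $[0,1]^2$. Then, with probability tending to $1$ as $n\to\infty$, there is a $(1+\varepsilon,1+\varepsilon)$-network for $P_n$ for every $\alpha$ with $0<\alpha<\alpha_n$ simultaneously. More precisely, with probability tending to $1$ the following holds for all these $\alpha$: the parameters $k=k_\varepsilon$, $t=1+\frac\varepsilon2$, $b=4$, $c=2k_\varepsilon b\frac{\alpha}{\varepsilon}$ are admissible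 for Algorithm 1 on $P_n$, Algorithm 1 has an output for them, and every output is a $(1+\varepsilon,1+\varepsilon)$-network. -/

import Mathlib

open MeasureTheory ProbabilityTheory Filter Topology Asymptotics
open scoped ENNReal

noncomputable section

namespace EuclideanGNCG

section Game

variable {V : Type*} [Fintype V] [DecidableEq V] {d : ℕ}

/-- A strategy of agent `u`: the finite set of other agents towards which `u` buys an edge. -/
abbrev Strategy (u : V) : Type _ := {S : Finset V // u ∉ S}

/-- A strategy profile: one strategy for every agent. -/
abbrev Profile (V : Type*) : Type _ := (u : V) → Strategy u

/-- The undirected network created by a strategy profile. -/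
def network (s : Profile V) : SimpleGraph V where
  Adj u v := v ∈ (s u).1 ∨ u ∈ (s v).1
  symm := ⟨fun _ _ h => Or.symm h⟩
  loopless := ⟨fun u h => h.elim (s u).2 (s u).2⟩

/-- The total Euclidean length of a walk, where agent `v` sits at the point `p v`. -/
def walkLength (p : V → EuclideanSpace ℝ (Fin d)) {G : SimpleGraph V} {u v : V}
    (w : G.Walk u v) : ℝ≥0∞ :=
  (w.darts.map fun e => edist (p e.fst) (p e.snd)).sum

/-- The distance of `u` and `v` in the network `G` with Euclidean edge lengths; it is `∞` if
there is no walk from `u` to `v` in `G`. -/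
def netDist (p : V → EuclideanSpace ℝ (Fin d)) (G : SimpleGraph V) (u v : V) : ℝ≥0∞ :=
  ⨅ w : G.Walk u v, walkLength p w

/-- The cost of agent `u`: edge cost plus distance cost. -/
def cost (p : V → EuclideanSpace ℝ (Fin d)) (α : ℝ) (s : Profile V) (u : V) : ℝ≥0∞ :=
  ENNReal.ofReal α * ∑ v ∈ (s u).1, edist (p u) (p v) + ∑ v, netDist p (network s) u v

/-- The social cost of a strategy profile. -/
def socialCost (p : V → EuclideanSpace ℝ (Fin d)) (α : ℝ) (s : Profile V) : ℝ≥0∞ :=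
  ∑ u, cost p α s u

/-- The social cost of a social optimum (there are finitely many profiles, so the infimum is
attained). -/
def optSocialCost (p : V → EuclideanSpace ℝ (Fin d)) (α : ℝ) : ℝ≥0∞ :=
  ⨅ s : Profile V, socialCost p α s

/-- `β`-approximate Nash equilibrium: no agent can improve her cost by more than a factor `β`
by changing only her own strategy. -/
def IsApproxNE (p : V → EuclideanSpace ℝ (Fin d)) (α β : ℝ) (s : Profile V) : Prop :=
  ∀ (u : V) (S : Strategy u),
    cost p α s u ≤ ENNReal.ofReal β * cost p α (Function.update s u S) u

/-- The profile `s` is a `(β, γ)`-NE, that is, its network is a `(β, γ)`-network. -/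
def IsBetaGammaNE (p : V → EuclideanSpace ℝ (Fin d)) (α β γ : ℝ) (s : Profile V) : Prop :=
  IsApproxNE p α β s ∧ socialCost p α s ≤ ENNReal.ofReal γ * optSocialCost p α

/-- `H` is a `k`-degree `t`-spanner on the agents in `C`: all its edges are inside `C`, all
degrees are at most `k`, and it stretches distances between agents in `C` by at most `t`. -/
def IsDegreeSpannerOn (p : V → EuclideanSpace ℝ (Fin d)) (C : Set V) (k : ℕ) (t : ℝ)
    (H : SimpleGraph V) : Prop :=
  (∀ u v, H.Adj u v → u ∈ C ∧ v ∈ C) ∧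
  (∀ u, (H.neighborSet u).ncard ≤ k) ∧
  ∀ u ∈ C, ∀ v ∈ C, netDist p H u v ≤ ENNReal.ofReal t * edist (p u) (p v)

/-- `o` assigns every edge of `H` to exactly one of its two endpoints such that each agent owns
at most `k` edges. -/
def IsOwnership (H : SimpleGraph V) (k : ℕ) (o : Profile V) : Prop :=
  network o = H ∧ (∀ u v, v ∈ (o u).1 → u ∉ (o v).1) ∧ ∀ u, (o u).1.card ≤ k

/-- The largest distance of two of the points. -/
def wMax (p : V → EuclideanSpace ℝ (Fin d)) : ℝ := Metric.diam (Set.range p)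

/-- The agents at distance at most `r` from agent `v`. -/
def closeTo (p : V → EuclideanSpace ℝ (Fin d)) (v : V) (r : ℝ) : Set V :=
  {u | dist (p u) (p v) ≤ r}

/-- The condition of the algorithm's case distinction for agent `v`: fewer than `c` agents are
outside `B_v`, i.e. farther than `w_max / b` from `v`. -/
def IsClusterCentre (p : V → EuclideanSpace ℝ (Fin d)) (b c : ℝ) (v : V) : Prop :=
  (((closeTo p v (wMax p / b))ᶜ.ncard : ℕ) : ℝ) < c

/-- The first case of the algorithm, run with the cluster centre `v` and
`C_v = closeTo p v (2 * w_max / b)`: a `k`-degree `t`-spanner on `C_v` with an ownership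
assignment, and every agent outside `C_v` buys one edge, to an agent of `C_v` closest to her. -/
def IsClusterOutput (p : V → EuclideanSpace ℝ (Fin d)) (k : ℕ) (t b : ℝ) (v : V)
    (s : Profile V) : Prop :=
  ∃ (H : SimpleGraph V) (o : Profile V),
    IsDegreeSpannerOn p (closeTo p v (2 * (wMax p / b))) k t H ∧ IsOwnership H k o ∧
    (∀ u ∈ closeTo p v (2 * (wMax p / b)), s u = o u) ∧
    ∀ u ∉ closeTo p v (2 * (wMax p / b)), ∃ u' ∈ closeTo p v (2 * (wMax p / b)),
      (∀ x ∈ closeTo p v (2 * (wMax p / b)), dist (p u) (p u') ≤ dist (p u) (p x)) ∧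
      (s u).1 = {u'}

/-- The second case of the algorithm: a `k`-degree `t`-spanner on all agents with an ownership
assignment. -/
def IsSpannerOutput (p : V → EuclideanSpace ℝ (Fin d)) (k : ℕ) (t : ℝ)
    (s : Profile V) : Prop :=
  ∃ H : SimpleGraph V, IsDegreeSpannerOn p Set.univ k t H ∧ IsOwnership H k s

/-- `s` is a possible output of the algorithm on the points `p` with parameters `k, t, b, c`.
The algorithm leaves open which cluster centre, which spanner, which ownership assignment and
which closest points are taken, so it is a relation. -/
def IsAlgorithmOutput (p : V → EuclideanSpace ℝ (Fin d)) (k : ℕ) (t b c : ℝ)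
    (s : Profile V) : Prop :=
  (∃ v, IsClusterCentre p b c v ∧ IsClusterOutput p k t b v s) ∨
  ((¬ ∃ v, IsClusterCentre p b c v) ∧ IsSpannerOutput p k t s)

/-- The constraints on the real parameters in the input of the algorithm, for `n` points. -/
def AdmissibleParams (n : ℕ) (t b c : ℝ) : Prop :=
  1 < t ∧ 1 ≤ b ∧ 0 ≤ c ∧ c ≤ (n : ℝ) - 1

end Game

section RandomPoints

/-- The unit square `[0,1]²` in the Euclidean plane. -/
def unitSquare : Set (EuclideanSpace ℝ (Fin 2)) := {x | ∀ i, x i ∈ Set.Icc (0 : ℝ) 1}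

/-- The uniform distribution on the unit square. -/
def uniformSquare : Measure (EuclideanSpace ℝ (Fin 2)) := cond volume unitSquare

/-- The joint law of `n` independent, uniformly distributed points of the unit square. -/
def randomPoints (n : ℕ) : Measure (Fin n → EuclideanSpace ℝ (Fin 2)) :=
  Measure.pi fun _ => uniformSquare

theorem volume_unitSquare : volume unitSquare = 1 := by
  have hs : unitSquare = (MeasurableEquiv.toLp 2 (Fin 2 → ℝ)).symm ⁻¹'
      (Set.univ.pi fun _ => Set.Icc (0 : ℝ) 1) := by
    ext x
    simp only [unitSquare, Set.mem_ofPred_eq, Set.mem_preimage, Set.mem_univ_pi]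
    rfl
  rw [hs, (EuclideanSpace.volume_preserving_symm_measurableEquiv_toLp
    (Fin 2)).measure_preimage_equiv, volume_pi_pi]
  simp

instance : IsProbabilityMeasure uniformSquare :=
  cond_isProbabilityMeasure_of_finite (by rw [volume_unitSquare]; exact one_ne_zero)
    (by rw [volume_unitSquare]; exact ENNReal.one_ne_top)

instance (n : ℕ) : IsProbabilityMeasure (randomPoints n) := by
  unfold randomPoints
  infer_instance

end RandomPoints

end EuclideanGNCG

end

/-! Network distances dominate Euclidean ones, so under every profile an agent pays at least the sum
of her Euclidean distances to all points. A profile in which everybody pays at most `1 + ε` times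
this sum is therefore both an approximate equilibrium and approximately optimal
(`isBetaGammaNE_of_cost_le`).

In a `(1 + ε/2)`-spanner the distance cost uses the factor `1 + ε/2`, and the remaining `ε/2` has to
cover at most `k` owned edges of length at most `wMax`. It does for every agent who is not a cluster
centre, because she has enough points at distance more than `wMax / 4` (`cost_le_of_spannerOutput`).

For random points, two opposite strips of the square each receive linearly many points, while the
threshold `c` is `o(n)`. Every agent is far from one of the strips, so no cluster centre exists and
only the spanner case of the algorithm occurs. Greedy spanners of bounded degree
(`exists_degreeSpanner`) show that it has an output. -/

namespace EuclideanGNCG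

/-! ### Network distance as an extended metric. -/

section NetDist

variable {V : Type*} {d : ℕ} (p : V → EuclideanSpace ℝ (Fin d)) {G H : SimpleGraph V}

theorem edist_le_walkLength {u v : V} (w : G.Walk u v) : edist (p u) (p v) ≤ walkLength p w := by
  induction w with
  | nil => simp
  | cons h w ih =>
    simp only [walkLength, SimpleGraph.Walk.darts_cons, List.map_cons, List.sum_cons] at ih ⊢
    exact (edist_triangle _ _ _).trans (by gcongr)

theorem edist_le_netDist (u v : V) : edist (p u) (p v) ≤ netDist p G u v :=
  le_iInf fun w => edist_le_walkLength p w

theorem netDist_le_of_adj {u v : V} (h : G.Adj u v) : netDist p G u v ≤ edist (p u) (p v) :=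
  (iInf_le _ h.toWalk).trans (by simp [walkLength])

theorem netDist_self (u : V) : netDist p G u u = 0 :=
  le_antisymm ((iInf_le _ SimpleGraph.Walk.nil).trans (by simp [walkLength])) zero_le

theorem netDist_triangle (u v w : V) : netDist p G u w ≤ netDist p G u v + netDist p G v w := by
  simp only [netDist]
  refine ENNReal.le_iInf_add_iInf fun x y => (iInf_le _ (x.append y)).trans ?_
  simp [walkLength]

theorem netDist_comm (u v : V) : netDist p G u v = netDist p G v u := by
  have key : ∀ u v : V, netDist p G u v ≤ netDist p G v u := fun u v =>
    le_iInf fun w => (iInf_le _ w.reverse).trans (le_of_eq (by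
      simp [walkLength, SimpleGraph.Walk.darts_reverse, List.sum_reverse, Function.comp_def,
        edist_comm]))
  exact le_antisymm (key u v) (key v u)

theorem netDist_anti (h : G ≤ H) (u v : V) : netDist p H u v ≤ netDist p G u v :=
  le_iInf fun w => (iInf_le _ (w.mapLe h)).trans (le_of_eq (by
    simp [walkLength, Function.comp_def, SimpleGraph.Walk.mapLe]))

end NetDist

/-! ### Bounded-degree greedy spanners. -/

section Greedy

variable {V : Type*} {d : ℕ} (p : V → EuclideanSpace ℝ (Fin d))

/-- Run on a finite set of pairs that is closed under passing to shorter pairs, the greedy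
algorithm yields a graph that stretches these pairs by at most `t` and in which no edge `uw` can be
replaced by a shorter edge `uv` followed by a `t`-path from `v` to `w`. -/
theorem exists_greedy_graph [DecidableEq V] {t : ℝ} (ht : 1 ≤ t) (E : Finset (V × V))
    (hE : ∀ x ∈ E, ∀ y : V × V, dist (p y.1) (p y.2) < dist (p x.1) (p x.2) → y ∈ E) :
    ∃ H : SimpleGraph V,
      (∀ x ∈ E, netDist p H x.1 x.2 ≤ ENNReal.ofReal t * edist (p x.1) (p x.2)) ∧
      (∀ u v, H.Adj u v → (u, v) ∈ E ∨ (v, u) ∈ E) ∧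
      ∀ u v w, H.Adj u v → H.Adj u w → v ≠ w → dist (p u) (p v) ≤ dist (p u) (p w) →
        dist (p v) (p w) < dist (p u) (p w) →
        t * dist (p u) (p w) < dist (p u) (p v) + t * dist (p v) (p w) := by
  -- The pair inserted last is a longest one, so pairs are processed by increasing length.
  induction E using Finset.induction_on_max_value (fun x : V × V => dist (p x.1) (p x.2)) with
  | empty => exact ⟨⊥, by simp⟩
  | insert a E ha hmax ih =>
    obtain ⟨x, y⟩ := a
    simp only at hmax
    obtain ⟨H, hst, hsub, hang⟩ := ih fun z hz z' hz' => by
      rcases Finset.mem_insert.1 (hE z (Finset.mem_insert_of_mem hz) z' hz') with rfl | h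
      · exact absurd (hmax z hz) (not_le.2 hz')
      · exact h
    have hshort : ∀ v w, dist (p v) (p w) < dist (p x) (p y) → (v, w) ∈ E := fun v w h => by
      rcases Finset.mem_insert.1 (hE (x, y) (Finset.mem_insert_self _ _) (v, w) h) with h' | h'
      · simp only [Prod.mk.injEq] at h'
        rw [h'.1, h'.2] at h
        exact absurd h (lt_irrefl _)
      · exact h'
    by_cases hxy : netDist p H x y ≤ ENNReal.ofReal t * edist (p x) (p y)
    · refine ⟨H, fun z hz => ?_, fun u v h => ?_, hang⟩
      · rcases Finset.mem_insert.1 hz with rfl | h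
        · exact hxy
        · exact hst z h
      · exact (hsub u v h).imp (Finset.mem_insert_of_mem ·) (Finset.mem_insert_of_mem ·)
    have hlen : ∀ u v, H.Adj u v → dist (p u) (p v) ≤ dist (p x) (p y) := fun u v h => by
      rcases hsub u v h with h | h
      · exact hmax (u, v) h
      · rw [dist_comm]; exact hmax (v, u) h
    -- a new edge with a short old edge at one of its ends
    have hnew : ∀ u v w, (u = x ∧ w = y ∨ u = y ∧ w = x) → H.Adj u v →
        dist (p v) (p w) < dist (p u) (p w) →
        t * dist (p u) (p w) < dist (p u) (p v) + t * dist (p v) (p w) := by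
      intro u v w huw huv hvw
      have h1 : dist (p u) (p w) = dist (p x) (p y) := by
        rcases huw with ⟨rfl, rfl⟩ | ⟨rfl, rfl⟩
        · rfl
        · exact dist_comm _ _
      by_contra hcon
      apply hxy
      -- The detour through `v` would already be a `t`-path, and greedy would not have added the
      -- edge.
      have h2 : netDist p H u w ≤ ENNReal.ofReal t * edist (p u) (p w) := by
        refine (netDist_triangle p u v w).trans ?_
        refine (add_le_add (netDist_le_of_adj p huv) (hst _ (hshort v w (h1 ▸ hvw)))).trans ?_
        simp only [edist_dist]
        rw [← ENNReal.ofReal_mul (by linarith), ← ENNReal.ofReal_mul (by linarith),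
          ← ENNReal.ofReal_add dist_nonneg (by positivity)]
        exact ENNReal.ofReal_le_ofReal (not_lt.1 hcon)
      rcases huw with ⟨rfl, rfl⟩ | ⟨rfl, rfl⟩
      · exact h2
      · rwa [netDist_comm, edist_comm] at h2
    have hne : x ≠ y := by
      rintro rfl
      exact hxy (by simp [netDist_self])
    have hadj : ∀ u v, (H ⊔ SimpleGraph.edge x y).Adj u v ↔
        H.Adj u v ∨ (u = x ∧ v = y ∨ u = y ∧ v = x) := by
      intro u v
      simp only [SimpleGraph.sup_adj, SimpleGraph.edge_adj]
      constructor
      · rintro (h | ⟨h, -⟩)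
        · exact Or.inl h
        · exact Or.inr (by tauto)
      · rintro (h | h)
        · exact Or.inl h
        · refine Or.inr ⟨by tauto, ?_⟩
          rcases h with ⟨rfl, rfl⟩ | ⟨rfl, rfl⟩
          exacts [hne, hne.symm]
    refine ⟨H ⊔ SimpleGraph.edge x y, fun z hz => ?_, fun u v h => ?_, ?_⟩
    · rcases Finset.mem_insert.1 hz with rfl | h
      · refine (netDist_le_of_adj p ((hadj x y).2 (by tauto))).trans ?_
        exact le_mul_of_one_le_left zero_le (ENNReal.one_le_ofReal.2 ht)
      · exact (netDist_anti p le_sup_left _ _).trans (hst z h)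
    · rcases (hadj u v).1 h with h | ⟨rfl, rfl⟩ | ⟨rfl, rfl⟩
      · exact (hsub u v h).imp (Finset.mem_insert_of_mem ·) (Finset.mem_insert_of_mem ·)
      · exact Or.inl (Finset.mem_insert_self _ _)
      · exact Or.inr (Finset.mem_insert_self _ _)
    · intro u v w huv huw hvw hle hlt
      rcases (hadj u w).1 huw with huw | huw
      · rcases (hadj u v).1 huv with huv | huv
        · exact hang u v w huv huw hvw hle hlt
        -- The new edge is a longest one, so this is a tie, and `hnew` applies with `v` and `w`
        -- exchanged.
        · have h1 : dist (p u) (p v) = dist (p u) (p w) := by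
            refine le_antisymm hle ((hlen u w huw).trans (le_of_eq ?_))
            rcases huv with ⟨rfl, rfl⟩ | ⟨rfl, rfl⟩
            · rfl
            · exact dist_comm _ _
          have := hnew u w v huv huw (by rwa [dist_comm, h1])
          rw [dist_comm (p w), h1] at this
          rwa [h1]
      · rcases (hadj u v).1 huv with huv | huv
        · exact hnew u v w huw huv hlt
        · exact absurd (by grind) hvw

/-- The angle property of greedy graphs, in terms of unit direction vectors. -/
theorem direction_dist_ge {E : Type*} [NormedAddCommGroup E] [NormedSpace ℝ E] {t : ℝ}
    (ht : 1 < t) {a b : E} (ha : a ≠ 0) (hab : ‖a‖ ≤ ‖b‖)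
    (h : ‖a - b‖ < ‖b‖ → t * ‖b‖ < ‖a‖ + t * ‖a - b‖) :
    (t - 1) / t ≤ dist (‖a‖⁻¹ • a) (‖b‖⁻¹ • b) := by
  by_contra! hlt
  rw [dist_eq_norm] at hlt
  set D := ‖‖a‖⁻¹ • a - ‖b‖⁻¹ • b‖
  have ha' : 0 < ‖a‖ := norm_pos_iff.2 ha
  have hb' : 0 < ‖b‖ := ha'.trans_le hab
  -- Rotate `a` into the direction of `b` at constant length, then move radially.
  have hdec : a - b = ‖a‖ • (‖a‖⁻¹ • a - ‖b‖⁻¹ • b) + (‖a‖ - ‖b‖) • (‖b‖⁻¹ • b) := by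
    rw [smul_sub, sub_smul, smul_inv_smul₀ ha'.ne', smul_inv_smul₀ hb'.ne']
    abel
  have hn : ‖a - b‖ ≤ ‖a‖ * D + (‖b‖ - ‖a‖) := by
    rw [hdec]
    refine (norm_add_le _ _).trans (le_of_eq ?_)
    rw [norm_smul, norm_smul, norm_smul ‖b‖⁻¹, norm_norm, norm_inv, norm_norm,
      inv_mul_cancel₀ hb'.ne', Real.norm_eq_abs, abs_sub_comm, abs_of_nonneg (sub_nonneg.2 hab)]
    ring
  have ht0 : 0 < t := by linarith
  have h1 : t * D < t - 1 := by rwa [lt_div_iff₀ ht0, mul_comm] at hlt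
  have h2 : t * ‖a - b‖ ≤ ‖a‖ * (t * D) + t * (‖b‖ - ‖a‖) := by
    calc t * ‖a - b‖ ≤ t * (‖a‖ * D + (‖b‖ - ‖a‖)) := by gcongr
      _ = _ := by ring
  have h3 : ‖a‖ * (t * D) < ‖a‖ * (t - 1) := by gcongr
  -- In fact `t * ‖a - b‖ < t * ‖b‖ - ‖a‖`: this gives the premise of `h` and contradicts its
  -- conclusion.
  have h4 : t * ‖a - b‖ < t * ‖b‖ := by nlinarith
  have := h (lt_of_mul_lt_mul_left h4 ht0.le)
  nlinarith

/-- Finitely many balls of radius `δ / 2` cover the compact sphere, and each contains at most one of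
the separated points. Applied to edge directions, this bounds the degree. -/
theorem exists_card_le_of_separated_sphere (d : ℕ) {δ : ℝ} (hδ : 0 < δ) :
    ∃ k : ℕ, ∀ {ι : Type} (s : Set ι) (e : ι → EuclideanSpace ℝ (Fin d)),
      (∀ i ∈ s, ‖e i‖ = 1) → (∀ i ∈ s, ∀ j ∈ s, i ≠ j → δ ≤ dist (e i) (e j)) → s.ncard ≤ k := by
  obtain ⟨c, -, hc, hcov⟩ := (isCompact_sphere (0 : EuclideanSpace ℝ (Fin d)) 1).finite_cover_balls
    (half_pos hδ)
  refine ⟨c.ncard, fun {ι} s e he hsep => ?_⟩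
  have : ∀ i ∈ s, ∃ x ∈ c, dist (e i) x < δ / 2 := fun i hi => by
    simpa using hcov (show e i ∈ _ by simp [he i hi])
  choose! f hf hdist using this
  refine Set.ncard_le_ncard_of_injOn f hf (fun i hi j hj hij => ?_) hc
  by_contra hne
  have h1 := hdist i hi
  have h2 := hdist j hj
  rw [← hij] at h2
  have := dist_triangle_right (e i) (e j) (f i)
  linarith [hsep i hi j hj hne]

/-- Every finite set of distinct points has a `t`-spanner whose degrees are bounded in terms of `t`
and the dimension. -/
theorem exists_degreeSpanner (d : ℕ) {t : ℝ} (ht : 1 < t) :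
    ∃ k : ℕ, ∀ {V : Type} [Fintype V] (p : V → EuclideanSpace ℝ (Fin d)), Function.Injective p →
      ∃ H : SimpleGraph V, IsDegreeSpannerOn p Set.univ k t H := by
  classical
  obtain ⟨k, hk⟩ := exists_card_le_of_separated_sphere d
    (div_pos (sub_pos.2 ht) (by linarith) : 0 < (t - 1) / t)
  refine ⟨k, fun {V} _ p hp => ?_⟩
  obtain ⟨H, hst, -, hang⟩ := exists_greedy_graph p ht.le Finset.univ (by simp)
  refine ⟨H, by simp, fun u => ?_, fun u _ v _ => hst (u, v) (Finset.mem_univ _)⟩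
  have hne : ∀ v, H.Adj u v → p v - p u ≠ 0 := fun v h =>
    sub_ne_zero.2 (hp.ne h.ne')
  have key : ∀ v w, H.Adj u v → H.Adj u w → v ≠ w → ‖p v - p u‖ ≤ ‖p w - p u‖ →
      (t - 1) / t ≤ dist (‖p v - p u‖⁻¹ • (p v - p u)) (‖p w - p u‖⁻¹ • (p w - p u)) :=
    fun v w hv hw hvw hle => direction_dist_ge ht (hne v hv) hle (by
      have := hang u v w hv hw hvw
      rw [dist_comm (p u), dist_comm (p u), dist_eq_norm, dist_eq_norm, dist_eq_norm] at this
      simpa using this hle)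
  refine hk (H.neighborSet u) (fun v => ‖p v - p u‖⁻¹ • (p v - p u)) (fun v hv => ?_)
    fun v hv w hw hvw => ?_
  · exact norm_smul_inv_norm (𝕜 := ℝ) (hne v hv)
  · rcases le_total ‖p v - p u‖ ‖p w - p u‖ with h | h
    · exact key v w hv hw hvw h
    · rw [dist_comm]; exact key w v hw hv hvw.symm h

/-- Let the smaller endpoint own the edge; the edges owned are then among the incident ones. -/
theorem exists_isOwnership {V : Type*} [Fintype V] [LinearOrder V] {k : ℕ} (H : SimpleGraph V)
    (hk : ∀ u, (H.neighborSet u).ncard ≤ k) : ∃ o : Profile V, IsOwnership H k o := by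
  classical
  refine ⟨fun u => ⟨Finset.univ.filter fun v => H.Adj u v ∧ u < v, by simp⟩, ?_, ?_, fun u => ?_⟩
  · ext u v
    simp only [network, Finset.mem_filter, Finset.mem_univ, true_and]
    constructor
    · rintro (h | h)
      exacts [h.1, h.1.symm]
    · intro h
      rcases lt_or_gt_of_ne h.ne with h' | h'
      exacts [Or.inl ⟨h, h'⟩, Or.inr ⟨h.symm, h'⟩]
  · intro u v huv hvu
    simp only [Finset.mem_filter, Finset.mem_univ, true_and] at huv hvu
    exact lt_asymm huv.2 hvu.2
  · refine le_trans ?_ (hk u)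
    rw [← Set.ncard_coe_finset]
    exact Set.ncard_le_ncard (fun v hv => by simp at hv; exact hv.1) (Set.toFinite _)

end Greedy

/-! ### Spanners without cluster centres are approximate equilibria and near-optimal. -/

section SpannerIsNE

variable {V : Type*} [Fintype V] {d : ℕ} {p : V → EuclideanSpace ℝ (Fin d)}

theorem sum_edist_le_cost {α : ℝ} (s : Profile V) (u : V) :
    ∑ v, edist (p u) (p v) ≤ cost p α s u :=
  (Finset.sum_le_sum fun v _ => edist_le_netDist p u v).trans le_add_self

theorem dist_le_wMax (u v : V) : dist (p u) (p v) ≤ wMax p :=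
  Metric.dist_le_diam_of_mem (Set.finite_range p).isBounded ⟨u, rfl⟩ ⟨v, rfl⟩

/-- At least `c` agents lie outside the ball, and each contributes more than `wMax p / b`. This is
the lower bound that pays for the edges. -/
theorem mul_wMax_le_sum_dist {b c : ℝ} (hb : 0 ≤ b) {v : V} (h : ¬ IsClusterCentre p b c v) :
    c * (wMax p / b) ≤ ∑ u, dist (p v) (p u) := by
  classical
  have hw : 0 ≤ wMax p / b := div_nonneg Metric.diam_nonneg hb
  set B := (closeTo p v (wMax p / b))ᶜ
  have hc : c ≤ (B.ncard : ℝ) := not_lt.1 h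
  calc c * (wMax p / b) ≤ B.ncard * (wMax p / b) := by gcongr
    _ = ∑ u ∈ B.toFinset, wMax p / b := by simp [Set.ncard_eq_toFinset_card']
    _ ≤ ∑ u ∈ B.toFinset, dist (p v) (p u) := by
      refine Finset.sum_le_sum fun u hu => ?_
      rw [dist_comm]
      exact (not_le.1 (show ¬ dist (p u) (p v) ≤ wMax p / b from Set.mem_toFinset.1 hu)).le
    _ ≤ ∑ u, dist (p v) (p u) :=
      Finset.sum_le_sum_of_subset_of_nonneg (Finset.subset_univ _) fun _ _ _ => dist_nonneg

/-- In a spanner, an agent with many far away agents pays at most `1 + ε` times her trivial lower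
bound. -/
theorem cost_le_of_spannerOutput {ε α : ℝ} (hε : 0 < ε) (hα : 0 < α) {k : ℕ} {s : Profile V}
    (hs : IsSpannerOutput p k (1 + ε / 2) s) {u : V}
    (hu : ¬ IsClusterCentre p 4 (2 * k * 4 * α / ε) u) :
    cost p α s u ≤ ENNReal.ofReal (1 + ε) * ∑ v, edist (p u) (p v) := by
  obtain ⟨H, ⟨-, -, hst⟩, hH, -, hcard⟩ := hs
  have hsum : ∀ S : Finset V,
      ∑ v ∈ S, edist (p u) (p v) = ENNReal.ofReal (∑ v ∈ S, dist (p u) (p v)) := fun S => by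
    rw [ENNReal.ofReal_sum_of_nonneg fun _ _ => dist_nonneg]
    simp [edist_dist]
  have h1 : ∑ v, netDist p (network s) u v
      ≤ ENNReal.ofReal (1 + ε / 2) * ∑ v, edist (p u) (p v) := by
    rw [hH, Finset.mul_sum]
    exact Finset.sum_le_sum fun v _ => hst u trivial v trivial
  have h2 : ∑ v ∈ (s u).1, dist (p u) (p v) ≤ k * wMax p := by
    calc ∑ v ∈ (s u).1, dist (p u) (p v) ≤ ∑ v ∈ (s u).1, wMax p :=
          Finset.sum_le_sum fun v _ => dist_le_wMax u v
      _ = (s u).1.card * wMax p := by simp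
      _ ≤ k * wMax p := by
        gcongr
        · exact Metric.diam_nonneg
        · exact hcard u
  have h3 := mul_wMax_le_sum_dist (by norm_num) hu
  have h4 : α * ∑ v ∈ (s u).1, dist (p u) (p v) ≤ ε / 2 * ∑ v, dist (p u) (p v) := by
    calc α * ∑ v ∈ (s u).1, dist (p u) (p v) ≤ α * (k * wMax p) := by gcongr
      -- The choice of `c` makes `ε / 2` times the lower bound `h3` exactly the maximal edge cost.
      _ = ε / 2 * (2 * k * 4 * α / ε * (wMax p / 4)) := by field_simp
      _ ≤ _ := by gcongr
  refine (add_le_add_right h1 _).trans ?_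
  rw [hsum, hsum, ← ENNReal.ofReal_mul hα.le, ← ENNReal.ofReal_mul (by linarith),
    ← ENNReal.ofReal_mul (by linarith), ← ENNReal.ofReal_add
      (mul_nonneg hα.le (Finset.sum_nonneg fun _ _ => dist_nonneg))
      (mul_nonneg (by linarith) (Finset.sum_nonneg fun _ _ => dist_nonneg))]
  exact ENNReal.ofReal_le_ofReal (by linarith)

/-- The distance sum does not depend on the profile, so it bounds the cost after any deviation and
in the optimum alike. -/
theorem isBetaGammaNE_of_cost_le [DecidableEq V] {α β : ℝ} {s : Profile V}
    (h : ∀ u, cost p α s u ≤ ENNReal.ofReal β * ∑ v, edist (p u) (p v)) :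
    IsBetaGammaNE p α β β s := by
  refine ⟨fun u S => (h u).trans ?_, ?_⟩
  · gcongr; exact sum_edist_le_cost _ u
  · calc socialCost p α s ≤ ∑ u, ENNReal.ofReal β * ∑ v, edist (p u) (p v) :=
          Finset.sum_le_sum fun u _ => h u
      _ = ENNReal.ofReal β * ∑ u, ∑ v, edist (p u) (p v) := by rw [Finset.mul_sum]
      _ ≤ _ := by
        gcongr
        exact le_iInf fun s' => Finset.sum_le_sum fun u _ => sum_edist_le_cost s' u

end SpannerIsNE

/-! ### Almost sure properties and counts of random points. -/

section RandomPoints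

theorem isClosed_unitSquare : IsClosed unitSquare := by
  simp only [unitSquare, Set.mem_Icc, Set.ofPred_forall, Set.ofPred_and]
  exact isClosed_iInter fun i => (isClosed_le (by fun_prop) (by fun_prop)).inter
    (isClosed_le (by fun_prop) (by fun_prop))

theorem uniformSquare_eq : uniformSquare = volume.restrict unitSquare := by
  simp [uniformSquare, ProbabilityTheory.cond, volume_unitSquare]

instance : NullSingletonClass uniformSquare := by
  rw [uniformSquare_eq]; infer_instance

theorem uniformSquare_pos {U : Set (EuclideanSpace ℝ (Fin 2))} (hU : IsOpen U) (hne : U.Nonempty)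
    (hsub : U ⊆ unitSquare) : 0 < uniformSquare.real U := by
  refine ENNReal.toReal_pos ?_ (measure_ne_top _ _)
  rw [uniformSquare_eq, Measure.restrict_eq_self _ hsub]
  exact (hU.measure_pos _ hne).ne'

theorem randomPoints_ae_mem_unitSquare (n : ℕ) :
    ∀ᵐ p ∂randomPoints n, ∀ i, p i ∈ unitSquare := by
  refine ae_all_iff.2 fun i => ?_
  refine (Measure.quasiMeasurePreserving_eval (fun _ : Fin n => uniformSquare) i).ae ?_
  rw [uniformSquare_eq]
  exact ae_restrict_mem isClosed_unitSquare.measurableSet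

/-- Two points have the product law, for which the diagonal is null because the factors have no
atoms. The spanner construction needs distinct points. -/
theorem randomPoints_ae_injective (n : ℕ) : ∀ᵐ p ∂randomPoints n, Function.Injective p := by
  have key : ∀ i j : Fin n, i ≠ j → ∀ᵐ p ∂randomPoints n, p i ≠ p j := by
    intro i j hij
    have hind : IndepFun (fun p : Fin n → EuclideanSpace ℝ (Fin 2) => p i) (fun p => p j)
        (randomPoints n) :=
      (iIndepFun_pi (μ := fun _ : Fin n => uniformSquare) (X := fun _ x => x)
        fun _ => aemeasurable_id).indepFun hij
    have hmap : ∀ i, Measure.map (fun p : Fin n → EuclideanSpace ℝ (Fin 2) => p i)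
        (randomPoints n) = uniformSquare := fun i =>
      (measurePreserving_eval (fun _ : Fin n => uniformSquare) i).map_eq
    rw [indepFun_iff_map_prod_eq_prod_map_map (measurable_pi_apply i).aemeasurable
      (measurable_pi_apply j).aemeasurable, hmap, hmap] at hind
    have hd : ∀ᵐ z ∂(uniformSquare.prod uniformSquare), z.1 ≠ z.2 := by
      have hm : MeasurableSet {z : EuclideanSpace ℝ (Fin 2) × EuclideanSpace ℝ (Fin 2) |
          z.1 = z.2} := measurableSet_eq_fun measurable_fst measurable_snd
      rw [ae_iff]
      simp only [ne_eq, not_not]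
      rw [Measure.measure_prod_null hm]
      refine Eventually.of_forall fun x => ?_
      have : Prod.mk x ⁻¹' {z : EuclideanSpace ℝ (Fin 2) × EuclideanSpace ℝ (Fin 2) |
          z.1 = z.2} = {x} := by
        ext y; simp [eq_comm]
      simp [this]
    rw [← hind] at hd
    exact ae_of_ae_map
      ((measurable_pi_apply i).prodMk (measurable_pi_apply j)).aemeasurable hd
  have : ∀ᵐ p ∂randomPoints n, ∀ i j : Fin n, i ≠ j → p i ≠ p j := by
    simp only [ae_all_iff]
    exact key
  filter_upwards [this] with p hp i j hij
  by_contra h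
  exact hp i j h hij

/-- Weak law of large numbers for the number of points in a fixed region. -/
theorem tendsto_randomPoints_few_in_region {A : Set (EuclideanSpace ℝ (Fin 2))}
    (hA : MeasurableSet A) (hpos : 0 < uniformSquare.real A) :
    Tendsto (fun n : ℕ => randomPoints n
      {p | ({i | p i ∈ A}.ncard : ℝ) ≤ uniformSquare.real A / 2 * n}) atTop (𝓝 0) := by
  classical
  set q := uniformSquare.real A
  set f : EuclideanSpace ℝ (Fin 2) → ℝ := A.indicator 1
  have hfm : Measurable f := measurable_one.indicator hA
  have hf01 : ∀ x, f x ∈ Set.Icc (0 : ℝ) 1 := fun x => by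
    by_cases hx : x ∈ A <;> simp [f, hx]
  have hf : MemLp f 2 uniformSquare :=
    memLp_of_bounded (Eventually.of_forall hf01) hfm.aestronglyMeasurable 2
  have hvar : variance f uniformSquare ≤ 1 := by
    refine (variance_le_sq_of_bounded (Eventually.of_forall hf01) hfm.aemeasurable).trans ?_
    norm_num
  have hint : ∫ x, f x ∂uniformSquare = q := integral_indicator_one hA
  -- Chebyshev: the count has mean `q * n` and variance at most `n`, and the event is a deviation of
  -- at least `q / 2 * n`.
  have hbound : ∀ n : ℕ, 0 < n → randomPoints n {p | ({i | p i ∈ A}.ncard : ℝ) ≤ q / 2 * n} ≤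
      ENNReal.ofReal (4 / q ^ 2 * (1 / (n : ℝ))) := by
    intro n hn
    have hn' : (0 : ℝ) < n := Nat.cast_pos.2 hn
    set X : (Fin n → EuclideanSpace ℝ (Fin 2)) → ℝ := ∑ i : Fin n, fun p => f (p i)
    have hfi : ∀ i : Fin n, MemLp (fun p : Fin n → EuclideanSpace ℝ (Fin 2) => f (p i)) 2
        (randomPoints n) := fun i =>
      hf.comp_measurePreserving (measurePreserving_eval (fun _ : Fin n => uniformSquare) i)
    have hX : MemLp X 2 (randomPoints n) := memLp_finsetSum' _ fun i _ => hfi i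
    have hEX : ∫ p, X p ∂randomPoints n = n * q := by
      simp only [X, Finset.sum_apply]
      rw [integral_finsetSum _ fun i _ => (hfi i).integrable (by norm_num)]
      have : ∀ i : Fin n, ∫ p, f (p i) ∂randomPoints n = q := fun i => by
        rw [← hint, ← (measurePreserving_eval (fun _ : Fin n => uniformSquare) i).map_eq,
          integral_map (measurable_pi_apply i).aemeasurable hfm.aestronglyMeasurable]
        rfl
      simp [this]
    have hVX : variance X (randomPoints n) ≤ n := by
      have := variance_sum_pi (μ := fun _ : Fin n => uniformSquare) (X := fun _ => f) fun _ => hf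
      calc variance X (randomPoints n) = ∑ i : Fin n, variance f uniformSquare := this
        _ ≤ ∑ i : Fin n, (1 : ℝ) := Finset.sum_le_sum fun _ _ => hvar
        _ = n := by simp
    have hXc : ∀ p, X p = ({i | p i ∈ A}.ncard : ℝ) := fun p => by
      simp only [X, Finset.sum_apply, f, Set.indicator_apply, Pi.one_apply, Finset.sum_boole]
      rw [Set.ncard_eq_toFinset_card']
      simp
    have hc : 0 < q / 2 * n := by positivity
    refine (measure_mono fun p hp => ?_).trans
      ((meas_ge_le_variance_div_sq hX hc).trans (ENNReal.ofReal_le_ofReal ?_))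
    · simp only [Set.mem_ofPred_eq] at hp ⊢
      rw [hEX, hXc, abs_sub_comm]
      refine le_trans ?_ (le_abs_self _)
      linarith
    · calc variance X (randomPoints n) / (q / 2 * n) ^ 2 ≤ n / (q / 2 * n) ^ 2 := by gcongr
        _ = 4 / q ^ 2 * (1 / (n : ℝ)) := by field_simp; ring
  have hlim : Tendsto (fun n : ℕ => ENNReal.ofReal (4 / q ^ 2 * (1 / (n : ℝ)))) atTop (𝓝 0) := by
    have := (tendsto_one_div_atTop_nhds_zero_nat (𝕜 := ℝ)).const_mul (4 / q ^ 2)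
    rw [mul_zero] at this
    simpa using ENNReal.tendsto_ofReal this
  refine tendsto_of_tendsto_of_tendsto_of_le_of_le' tendsto_const_nhds hlim
    (Eventually.of_forall fun _ => zero_le) ?_
  filter_upwards [eventually_gt_atTop 0] with n hn using hbound n hn

end RandomPoints

/-! ### Side strips exclude cluster centres. -/

/-- The open part of the unit square where the first coordinate lies between `l` and `r`. -/
def openStrip (l r : ℝ) : Set (EuclideanSpace ℝ (Fin 2)) :=
  {x | (l < x 0 ∧ x 0 < r) ∧ 0 < x 1 ∧ x 1 < 1}

theorem isOpen_openStrip (l r : ℝ) : IsOpen (openStrip l r) := by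
  simp only [openStrip, Set.ofPred_and]
  exact ((isOpen_lt (by fun_prop) (by fun_prop)).inter
    (isOpen_lt (by fun_prop) (by fun_prop))).inter
    ((isOpen_lt (by fun_prop) (by fun_prop)).inter (isOpen_lt (by fun_prop) (by fun_prop)))

theorem uniformSquare_openStrip_pos {l r : ℝ} (hl : 0 ≤ l) (hlr : l < r) (hr : r ≤ 1) :
    0 < uniformSquare.real (openStrip l r) := by
  refine uniformSquare_pos (isOpen_openStrip l r) ⟨!₂[(l + r) / 2, 1 / 2], ?_⟩ fun x hx => ?_
  · simp only [openStrip, Set.mem_ofPred_eq]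
    refine ⟨⟨?_, ?_⟩, ?_, ?_⟩ <;> simp <;> linarith
  · obtain ⟨⟨h1, h2⟩, h3, h4⟩ := hx
    simp only [unitSquare, Set.mem_ofPred_eq, Fin.forall_fin_two, Set.mem_Icc]
    refine ⟨⟨?_, ?_⟩, ?_, ?_⟩ <;> linarith

/-- The crude bound `3 / 2` for `√2` suffices: it gives `wMax p / 4 ≤ 3 / 8`, the distance from the
middle line to either side strip. -/
theorem wMax_le_of_mem_unitSquare {V : Type*} {p : V → EuclideanSpace ℝ (Fin 2)}
    (hp : ∀ i, p i ∈ unitSquare) : wMax p ≤ 3 / 2 := by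
  refine Metric.diam_le_of_forall_dist_le (by norm_num) ?_
  rintro _ ⟨i, rfl⟩ _ ⟨j, rfl⟩
  have hi := hp i
  have hj := hp j
  simp only [unitSquare, Set.mem_ofPred_eq, Fin.forall_fin_two, Set.mem_Icc] at hi hj
  rw [EuclideanSpace.dist_eq, Fin.sum_univ_two, Real.dist_eq, Real.dist_eq, sq_abs, sq_abs]
  refine Real.sqrt_le_iff.2 ⟨by norm_num, ?_⟩
  have h0 : (p i 0 - p j 0) ^ 2 ≤ 1 := by
    rw [sq_le_one_iff_abs_le_one, abs_le]; constructor <;> linarith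
  have h1 : (p i 1 - p j 1) ^ 2 ≤ 1 := by
    rw [sq_le_one_iff_abs_le_one, abs_le]; constructor <;> linarith
  linarith

theorem abs_coord_sub_le_dist {d : ℕ} (x y : EuclideanSpace ℝ (Fin d)) (i : Fin d) :
    |x i - y i| ≤ dist x y := by
  rw [dist_eq_norm, ← Real.norm_eq_abs]
  exact PiLp.norm_apply_le (x - y) i

/-- If many points lie in both side strips of the square, then no agent is a cluster centre. -/
theorem not_isClusterCentre_of_strips {V : Type*} [Fintype V] {p : V → EuclideanSpace ℝ (Fin 2)}
    {c : ℝ} (hp : ∀ i, p i ∈ unitSquare)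
    (hleft : c ≤ ({i | p i ∈ openStrip 0 (1 / 8)}.ncard : ℝ))
    (hright : c ≤ ({i | p i ∈ openStrip (7 / 8) 1}.ncard : ℝ)) (v : V) :
    ¬ IsClusterCentre p 4 c v := by
  have hw := wMax_le_of_mem_unitSquare hp
  have key : ∀ S : Set V, c ≤ S.ncard → (∀ i ∈ S, 3 / 8 < |p i 0 - p v 0|) →
      ¬ IsClusterCentre p 4 c v := by
    intro S hS hfar
    refine not_lt.2 (hS.trans (Nat.cast_le.2 (Set.ncard_le_ncard (fun i hi => ?_)
      (Set.toFinite _))))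
    refine not_le.2 (lt_of_lt_of_le ?_ (abs_coord_sub_le_dist (p i) (p v) 0))
    linarith [hfar i hi]
  -- Use the strip on the side of the square away from `v`.
  rcases le_total (p v 0) (1 / 2) with h | h
  · refine key _ hright fun i hi => lt_of_lt_of_le ?_ (le_abs_self _)
    linarith [hi.1.1]
  · refine key _ hleft fun i hi => lt_of_lt_of_le ?_ (neg_le_abs _)
    linarith [hi.1.2]

end EuclideanGNCG

/-! ### Assembly for all `α` at once. -/

theorem mainTheorem11 (ε : ℝ) (hε : 0 < ε) :
    ∃ k : ℕ, ∀ a : ℕ → ℝ, a =o[atTop] (fun n : ℕ => (n : ℝ)) →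
      Tendsto
        (fun n : ℕ => EuclideanGNCG.randomPoints n
          {p : Fin n → EuclideanSpace ℝ (Fin 2) |
            ¬ ∀ α : ℝ, 0 < α → α < a n →
              EuclideanGNCG.AdmissibleParams n (1 + ε / 2) 4 (2 * k * 4 * α / ε) ∧
              (∃ s : EuclideanGNCG.Profile (Fin n),
                EuclideanGNCG.IsAlgorithmOutput p k (1 + ε / 2) 4 (2 * k * 4 * α / ε) s ∧
                EuclideanGNCG.IsBetaGammaNE p α (1 + ε) (1 + ε) s) ∧
              ∀ s : EuclideanGNCG.Profile (Fin n),
                EuclideanGNCG.IsAlgorithmOutput p k (1 + ε / 2) 4 (2 * k * 4 * α / ε) s →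
                EuclideanGNCG.IsBetaGammaNE p α (1 + ε) (1 + ε) s})
        atTop (𝓝 0) := by
  open EuclideanGNCG in
  obtain ⟨k, hk⟩ := exists_degreeSpanner 2 (t := 1 + ε / 2) (by linarith)
  refine ⟨k, fun a ha => ?_⟩
  have hq₁ := uniformSquare_openStrip_pos (l := 0) (r := 1 / 8) (by norm_num) (by norm_num)
    (by norm_num)
  have hq₂ := uniformSquare_openStrip_pos (l := 7 / 8) (r := 1) (by norm_num) (by norm_num)
    (by norm_num)
  have hlim := (tendsto_randomPoints_few_in_region (isOpen_openStrip _ _).measurableSet hq₁).add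
    (tendsto_randomPoints_few_in_region (isOpen_openStrip _ _).measurableSet hq₂)
  rw [add_zero] at hlim
  set q₁ := uniformSquare.real (openStrip 0 (1 / 8))
  set q₂ := uniformSquare.real (openStrip (7 / 8) 1)
  -- The first two bounds match the strip counts; `1 / 2` yields `c ≤ n - 1` once `n ≥ 2`.
  set m := min (min (q₁ / 2) (q₂ / 2)) (1 / 2)
  have hm : 0 < m := by positivity
  have hsmall : ∀ᶠ n : ℕ in atTop, ∀ α : ℝ, 0 < α → α < a n → 2 * k * 4 * α / ε ≤ m * n := by
    -- `k + 1` keeps the denominator positive even if `k = 0`.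
    filter_upwards [ha.def (show 0 < m * ε / (8 * (k + 1)) by positivity)] with n hn α hα hαn
    have h1 : α ≤ m * ε / (8 * (k + 1)) * n := by
      refine hαn.le.trans ((le_abs_self _).trans ?_)
      simpa using hn
    calc 2 * k * 4 * α / ε ≤ 2 * (k + 1) * 4 * (m * ε / (8 * (k + 1)) * n) / ε := by
          gcongr; linarith
      _ = m * n := by field_simp; ring
  refine tendsto_of_tendsto_of_tendsto_of_le_of_le' tendsto_const_nhds hlim
    (Eventually.of_forall fun _ => zero_le) ?_
  filter_upwards [hsmall, eventually_ge_atTop 2] with n hn hn2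
  refine le_trans ?_ (measure_union_le _ _)
  -- Up to a null set, failure for any `α` forces one of the two strips to be sparse, an event in
  -- which `α` does not occur.
  refine measure_mono_ae ?_
  filter_upwards [randomPoints_ae_mem_unitSquare n, randomPoints_ae_injective n] with p hsq hinj
  intro hbad
  by_contra hgood
  apply hbad
  obtain ⟨hl, hr⟩ := not_or.1 hgood
  rw [Set.mem_ofPred_eq, not_le] at hl hr
  intro α hα hαn
  have hc := hn α hα hαn
  have hn2' : (2 : ℝ) ≤ n := by exact_mod_cast hn2
  have hm₁ : m * n ≤ q₁ / 2 * n := by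
    gcongr; exact (min_le_left _ _).trans (min_le_left _ _)
  have hm₂ : m * n ≤ q₂ / 2 * n := by
    gcongr; exact (min_le_left _ _).trans (min_le_right _ _)
  have hm₃ : m * n ≤ 1 / 2 * n := by
    gcongr; exact min_le_right _ _
  have hno : ¬ ∃ v, IsClusterCentre p 4 (2 * k * 4 * α / ε) v := fun ⟨v, hv⟩ =>
    not_isClusterCentre_of_strips hsq (hc.trans (hm₁.trans hl.le)) (hc.trans (hm₂.trans hr.le)) v hv
  have hall : ∀ s : Profile (Fin n),
      IsAlgorithmOutput p k (1 + ε / 2) 4 (2 * k * 4 * α / ε) s →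
      IsBetaGammaNE p α (1 + ε) (1 + ε) s := by
    rintro s (⟨v, hv, -⟩ | ⟨-, hs⟩)
    · exact absurd ⟨v, hv⟩ hno
    · exact isBetaGammaNE_of_cost_le fun u =>
        cost_le_of_spannerOutput hε hα hs fun h => hno ⟨u, h⟩
  obtain ⟨H, hH⟩ := hk p hinj
  obtain ⟨o, ho⟩ := exists_isOwnership H hH.2.1
  have hout : IsAlgorithmOutput p k (1 + ε / 2) 4 (2 * k * 4 * α / ε) o :=
    Or.inr ⟨hno, H, hH, ho⟩
  exact ⟨⟨by linarith, by norm_num, by positivity, by linarith⟩, ⟨o, hout, hall o hout⟩, hall⟩
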